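/- Let $n\ge 1$ and let $\Omega\subset\mathbb R^n$ be a bounded domain (a nonempty bounded connected open set). For $\delta>0$ put $\Omega^\delta=\Omega\cap(\delta\mathbb Z)^n$, let $K^\delta$ be the number of points of $\Omega^\delta$, and let $\partial\Omega^\delta$ be the set of points of $(\delta\mathbb Z)^n\setminus\Omega^\delta$ that have at least one of their $2n$ lattice neighbours in $\Omega^\delta$. On $(\delta\mathbb Z)^m$ let $\Delta_{\delta,m}u(x)=\delta^{-2}\bigl(\sum_{j=1}^m(u(x+\delta e_j)+u(x-\delta e_j))-2m\,u(x)\bigr)$. Let $\lambda_1^\delta\le\dots\le\lambda_{K^\delta}^\delta$ be the eigenvalues, counted with multiplicity, of the Dirichlet problem $-\Delta_{\delta,n}f=\lambda f$ in $\Omega^\delta$, $f=0$ on $\partial\Omega^\delta$, and put $a_k^\delta=\delta^{-1}\cosh^{-1}\bigl(1+\tfrac12\delta^2\lambda_k^\delta\bigr)$. For $\delta>0$, real $N\ge 0$ that is an integer multiple of $\delta$, and $A\in\mathbb R$, call (P) the following condition on a real function $u$ on $(\Omega^\delta\cup\partial\Omega^\delta)\times([-N,N]\cap\delta\mathbb Z)$: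 $\Delta_{\delta,n+1}u\ge 0$ at every point $(x',x_{n+1})$ with $x'\in\Omega^\delta$ and $|x_{n+1}|<N$; $u(x',x_{n+1})=0$ for $x'\in\partial\Omega^\delta$; and, with $u^+=\max\{0,u\}$, $$\sum_{x'\in\Omega^\delta}u^+(x',0)^2=A^2K^\delta>0 .$$ 1. If $u$ satisfies (P), then $$\max_{\Omega^\delta\times([-N,N]\cap\delta\mathbb Z)}u\ \ge\ \frac A2\Bigl(\sum_{k=1}^{K^\delta}\exp(-a_k^\delta N)\Bigr)^{-1}.$$ 2. There is a constant $C_\Omega>0$ that depends only on $\Omega$ such that, for every $\delta>0$, every $N\in\mathbb N$ that is an integer multiple of $\delta$, every $A$ and every $u$ satisfying (P), $$\max_{\Omega^\delta\times([-N,N]\cap\delta\mathbb Z)}u\ \ge\ C_\Omega\,A\,\exp(a_1^\delta N).$$ -/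

import Mathlib

noncomputable section

/- The lattice `(δℤ)^m` is parametrized by `ℤ^m`: the integer vector `z` stands for the lattice
point `δ z`.  A function on a subset of the lattice is a function on `ℤ^m` of which only the
values on that subset are used. -/

/-- The `δ`-discrete Laplacian
`δ⁻² (∑_j (u (x + δ e_j) + u (x - δ e_j)) - 2 m u x)` on `(δℤ)^m`. -/
def discreteLaplacian {m : ℕ} (δ : ℝ) (u : (Fin m → ℤ) → ℝ) (z : Fin m → ℤ) : ℝ :=
  (δ ^ 2)⁻¹ * ((∑ j : Fin m, (u (z + Pi.single j 1) + u (z - Pi.single j 1))) - 2 * m * u z)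

/-- `u` is `δ`-discrete subharmonic in the set `D` of lattice points. -/
def IsDiscreteSubharmonic {m : ℕ} (δ : ℝ) (u : (Fin m → ℤ) → ℝ) (D : Set (Fin m → ℤ)) : Prop :=
  ∀ z ∈ D, 0 ≤ discreteLaplacian δ u z

/-- The discrete boundary of `D`: lattice points outside `D` with at least one neighbour in `D`. -/
def latticeBoundary {m : ℕ} (D : Set (Fin m → ℤ)) : Set (Fin m → ℤ) :=
  {z | z ∉ D ∧ ∃ j : Fin m, z + Pi.single j 1 ∈ D ∨ z - Pi.single j 1 ∈ D}

/-- The discretization `Ω ∩ (δℤ)^n` of a set `Ω ⊆ ℝⁿ`. -/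
def latticePoints {n : ℕ} (Ω : Set (EuclideanSpace ℝ (Fin n))) (δ : ℝ) : Set (Fin n → ℤ) :=
  {z | WithLp.toLp 2 (fun i => δ * (z i : ℝ)) ∈ Ω}

theorem latticePoints_finite {n : ℕ} {Ω : Set (EuclideanSpace ℝ (Fin n))} {δ : ℝ}
    (hΩ : Bornology.IsBounded Ω) (hδ : 0 < δ) : (latticePoints Ω δ).Finite := by
  obtain ⟨R, hR⟩ := hΩ.exists_norm_le
  refine (Set.Finite.pi' (fun _ : Fin n => Set.finite_Icc (-⌈R / δ⌉) ⌈R / δ⌉)).subset ?_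
  intro z hz i
  have h1 := (PiLp.norm_apply_le (WithLp.toLp 2 (fun i => δ * (z i : ℝ)) :
    EuclideanSpace ℝ (Fin n)) i).trans (hR _ hz)
  have h2 : |(z i : ℝ)| ≤ R / δ := by
    rw [le_div_iff₀ hδ]
    simpa [abs_mul, abs_of_pos hδ, mul_comm] using h1
  have h3 := (abs_le.1 h2)
  have h4 := Int.le_ceil (R / δ)
  constructor
  · have : ((-⌈R / δ⌉ : ℤ) : ℝ) ≤ z i := by push_cast; linarith
    exact_mod_cast this
  · have : (z i : ℝ) ≤ ((⌈R / δ⌉ : ℤ) : ℝ) := by linarith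
    exact_mod_cast this

/-- `Ω ∩ (δℤ)^n` as a finite set, for bounded `Ω` and `δ > 0`. -/
def latticeFinset {n : ℕ} {Ω : Set (EuclideanSpace ℝ (Fin n))} {δ : ℝ}
    (hΩ : Bornology.IsBounded Ω) (hδ : 0 < δ) : Finset (Fin n → ℤ) :=
  (latticePoints_finite hΩ hδ).toFinset

/-- Extension by zero of a function on a finite set of lattice points. -/
def extendByZero {m : ℕ} (S : Finset (Fin m → ℤ)) (g : S → ℝ) (z : Fin m → ℤ) : ℝ :=
  if h : z ∈ S then g ⟨z, h⟩ else 0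

/-- The operator `-Δ_δ` on `S` with zero Dirichlet condition: extend by zero, apply `-Δ_δ`,
restrict to `S`. -/
def dirichletLaplacian {m : ℕ} (δ : ℝ) (S : Finset (Fin m → ℤ)) : (S → ℝ) →ₗ[ℝ] (S → ℝ) where
  toFun g x := -discreteLaplacian δ (extendByZero S g) x
  map_add' g h := by
    have key : ∀ z, extendByZero S (g + h) z = extendByZero S g z + extendByZero S h z := by
      intro z
      unfold extendByZero
      split_ifs <;> simp
    funext x
    simp only [discreteLaplacian, key, Pi.add_apply, Finset.sum_add_distrib]
    ring
  map_smul' c g := by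
    have key : ∀ z, extendByZero S (c • g) z = c * extendByZero S g z := by
      intro z
      unfold extendByZero
      split_ifs <;> simp
    funext x
    simp only [discreteLaplacian, key, Pi.smul_apply, smul_eq_mul, RingHom.id_apply,
      Finset.sum_add_distrib, ← Finset.mul_sum]
    ring

/-- The matrix of the Dirichlet operator `-Δ_δ` on `S` in the standard basis. -/
def dirichletMatrix {m : ℕ} (δ : ℝ) (S : Finset (Fin m → ℤ)) : Matrix S S ℝ :=
  LinearMap.toMatrix' (dirichletLaplacian δ S)

theorem dirichletMatrix_isHermitian {m : ℕ} (δ : ℝ) (S : Finset (Fin m → ℤ)) :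
    (dirichletMatrix δ S).IsHermitian := by
  have key : ∀ (y : S) (z : Fin m → ℤ),
      extendByZero S (Pi.single y 1) z = if z = y.1 then 1 else 0 := by
    intro y z
    unfold extendByZero
    by_cases h : z ∈ S
    · simp [h, Pi.single_apply, Subtype.ext_iff]
    · have : z ≠ y.1 := fun e => h (e ▸ y.2)
      simp [h, this]
  ext x y
  simp only [Matrix.conjTranspose_apply, star_trivial, dirichletMatrix, LinearMap.toMatrix'_apply,
    dirichletLaplacian, LinearMap.coe_mk, AddHom.coe_mk, discreteLaplacian]
  have e1 : ∀ a b c : Fin m → ℤ, (a + c = b) = (b - c = a) := fun a b c => by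
    rw [eq_iff_iff]
    constructor <;> rintro rfl <;> simp
  have e5 : ∀ y : S, extendByZero S (Pi.single y 1)
      = fun z => if z = y.1 then 1 else 0 := fun y => funext (key y)
  have e3 : ((y : Fin m → ℤ) = (x : Fin m → ℤ)) = ((x : Fin m → ℤ) = (y : Fin m → ℤ)) :=
    propext eq_comm
  simp only [e5, e1, add_comm]
  simp only [e3]

/-- The `k`-th Dirichlet eigenvalue `λ_k` of `-Δ_δ` on `S`, for `1 ≤ k ≤ #S`, counted with
multiplicity in nondecreasing order `λ_1 ≤ λ_2 ≤ …`  (and `0` for other `k`).  The eigenvalues in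
Mathlib are in nonincreasing order, whence the reversal. -/
def dirichletEigenvalue {m : ℕ} (δ : ℝ) (S : Finset (Fin m → ℤ)) (k : ℕ) : ℝ :=
  if h : 1 ≤ k ∧ k ≤ Fintype.card S then
    (dirichletMatrix_isHermitian δ S).eigenvalues₀ (Fin.rev ⟨k - 1, by omega⟩)
  else 0

/-- `a_k = δ⁻¹ cosh⁻¹(1 + δ² λ_k / 2)`. -/
def cylinderExponent {m : ℕ} (δ : ℝ) (S : Finset (Fin m → ℤ)) (k : ℕ) : ℝ :=
  δ⁻¹ * Real.arcosh (1 + δ ^ 2 * dirichletEigenvalue δ S k / 2)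

/-- `Ω^δ × [-N, N]`: lattice points `(x', x_{n+1})` of `(δℤ)^{n+1}` with `x' ∈ Ω` and
`|x_{n+1}| ≤ N`. -/
def truncatedCylinder {n : ℕ} (Ω : Set (EuclideanSpace ℝ (Fin n))) (δ N : ℝ) :
    Set (Fin (n + 1) → ℤ) :=
  {p | Fin.init p ∈ latticePoints Ω δ ∧ |δ * (p (Fin.last n) : ℝ)| ≤ N}

/-- `Ω^δ × (-N, N)`. -/
def openTruncatedCylinder {n : ℕ} (Ω : Set (EuclideanSpace ℝ (Fin n))) (δ N : ℝ) :
    Set (Fin (n + 1) → ℤ) :=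
  {p | Fin.init p ∈ latticePoints Ω δ ∧ |δ * (p (Fin.last n) : ℝ)| < N}

/-- `∂Ω^δ × [-N, N]`. -/
def lateralBoundary {n : ℕ} (Ω : Set (EuclideanSpace ℝ (Fin n))) (δ N : ℝ) :
    Set (Fin (n + 1) → ℤ) :=
  {p | Fin.init p ∈ latticeBoundary (latticePoints Ω δ) ∧ |δ * (p (Fin.last n) : ℝ)| ≤ N}

/-- `u` is `δ`-discrete subharmonic in `Ω^δ × (-N, N)`, vanishes on `∂Ω^δ × [-N, N]`, and
`∑_{x' ∈ Ω^δ} u⁺(x', 0)² = A² K > 0`, where `K` is the number of points of `Ω^δ`. -/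
structure IsPositiveCylinderSubsolution {n : ℕ} {Ω : Set (EuclideanSpace ℝ (Fin n))} {δ : ℝ}
    (hΩ : Bornology.IsBounded Ω) (hδ : 0 < δ) (N A : ℝ) (u : (Fin (n + 1) → ℤ) → ℝ) : Prop where
  subharmonic : IsDiscreteSubharmonic δ u (openTruncatedCylinder Ω δ N)
  eq_zero : ∀ p ∈ lateralBoundary Ω δ N, u p = 0
  sum_eq : ∑ x ∈ latticeFinset hΩ hδ, (max 0 (u (Fin.snoc x (0 : ℤ)))) ^ 2
    = A ^ 2 * ((latticeFinset hΩ hδ).card : ℝ)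
  pos : 0 < A ^ 2 * ((latticeFinset hΩ hδ).card : ℝ)

end

/-!
Let `q t` be the `ℓ²` norm over `Ω^δ` of the positive part `u⁺ (·, t)`.  As `u⁺` is subharmonic,
pairing its subharmonicity inequality with `u⁺ (·, t)`, bounding the Dirichlet form from below by
`λ₁` and using the Cauchy–Schwarz inequality gives
`q (t + δ) + q (t - δ) ≥ (2 + δ² λ₁) q t = 2 cosh (δ a₁) q t`.
Comparison with `cosh (a₁ t)`, which satisfies the same relation with equality, yields
`q N + q (-N) ≥ 2 cosh (a₁ N) q 0`.  Now `q 0 = |A| √K`, while `q (± N) ≤ (max u⁺) √K`, so that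
`max u⁺ ≥ |A| cosh (a₁ N) ≥ (|A| / 2) exp (a₁ N) > 0`, and `exp (a₁ N) ≥ (∑ exp (-a_k N))⁻¹`.
-/

section ExpCosh

open Real

theorem inv_sum_exp_neg_le_exp {ι : Type*} {s : Finset ι} {i : ι} (hi : i ∈ s) (b : ι → ℝ) :
    (∑ k ∈ s, exp (-b k))⁻¹ ≤ exp (b i) := by
  rw [← neg_neg (b i), exp_neg (-b i)]
  exact inv_anti₀ (exp_pos _)
    (Finset.single_le_sum (f := fun k ↦ exp (-b k)) (fun k _ ↦ (exp_pos _).le) hi)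

theorem exp_half_le_cosh (x : ℝ) : exp x / 2 ≤ cosh x := by
  rw [cosh_eq]
  linarith [exp_pos (-x)]

theorem cosh_add_add_cosh_sub (x y : ℝ) : cosh (x + y) + cosh (x - y) = 2 * cosh y * cosh x := by
  rw [cosh_add, cosh_sub]
  ring

variable {θ : ℝ} {m : ℕ}

-- The Casoratian `cosh (t θ) G (t + 1) - cosh ((t + 1) θ) G t` is nondecreasing in `t`.
theorem cosh_succ_mul_le_of_recurrence {G : ℕ → ℝ} (h₀ : cosh θ * G 0 ≤ G 1)
    (hG : ∀ t, t + 1 < m → 2 * cosh θ * G (t + 1) ≤ G (t + 2) + G t) {t : ℕ} (ht : t < m) :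
    cosh ((t + 1) * θ) * G t ≤ cosh (t * θ) * G (t + 1) := by
  induction t with
  | zero => simpa using h₀
  | succ t ih =>
    have hcosh : cosh ((t + 1 + 1) * θ) + cosh (t * θ) = 2 * cosh θ * cosh ((t + 1) * θ) := by
      rw [← cosh_add_add_cosh_sub]
      congr 2 <;> ring
    have hstep := mul_le_mul_of_nonneg_left (hG t ht) (cosh_pos ((t + 1) * θ)).le
    push_cast
    linear_combination hstep + ih (by lia) + G (t + 1) * hcosh

theorem cosh_mul_le_of_recurrence {G : ℕ → ℝ} (h₀ : cosh θ * G 0 ≤ G 1)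
    (hG : ∀ t, t + 1 < m → 2 * cosh θ * G (t + 1) ≤ G (t + 2) + G t) {t : ℕ} (ht : t ≤ m) :
    cosh (t * θ) * G 0 ≤ G t := by
  induction t with
  | zero => simp
  | succ t ih =>
    have hstep := cosh_succ_mul_le_of_recurrence h₀ hG ht
    have hprev := mul_le_mul_of_nonneg_left (ih (by lia)) (cosh_pos ((t + 1) * θ)).le
    refine le_of_mul_le_mul_left ?_ (cosh_pos (t * θ))
    push_cast
    linear_combination hprev + hstep

theorem two_mul_cosh_mul_le_of_recurrence {q : ℤ → ℝ}
    (hq : ∀ t : ℤ, |t| < m → 2 * cosh θ * q t ≤ q (t + 1) + q (t - 1)) :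
    2 * (cosh (m * θ) * q 0) ≤ q m + q (-m) := by
  rcases m.eq_zero_or_pos with rfl | hm
  · simp [two_mul]
  have h₀ : cosh θ * (q 0 + q 0) ≤ q 1 + q (-1) := by
    have := hq 0 (by simpa using hm)
    simp only [zero_add, zero_sub] at this
    linarith
  have hsymm := cosh_mul_le_of_recurrence (θ := θ) (m := m) (G := fun t ↦ q t + q (-t))
    (by simpa using h₀) (fun t ht ↦ ?_) le_rfl
  · simp only [Nat.cast_zero, neg_zero] at hsymm
    linarith
  · have hpos := hq (t + 1) (by rw [abs_of_nonneg] <;> lia)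
    have hneg := hq (-(t + 1)) (by rw [abs_neg, abs_of_nonneg] <;> lia)
    rw [show (t : ℤ) + 1 + 1 = t + 2 by ring, show (t : ℤ) + 1 - 1 = t by ring] at hpos
    rw [show -((t : ℤ) + 1) + 1 = -t by ring, show -((t : ℤ) + 1) - 1 = -(t + 2) by ring] at hneg
    push_cast
    linarith

end ExpCosh

section Matrix

open Matrix
open scoped MatrixOrder

theorem mul_dotProduct_self_le_dotProduct_mulVec {ι : Type*} [Fintype ι] [DecidableEq ι]
    {B : Matrix ι ι ℝ} (hB : B.IsHermitian) {μ : ℝ} (hμ : ∀ i, μ ≤ hB.eigenvalues i)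
    (v : ι → ℝ) : μ * (v ⬝ᵥ v) ≤ v ⬝ᵥ (B *ᵥ v) := by
  have hle : algebraMap ℝ (Matrix ι ι ℝ) μ ≤ B := by
    rw [algebraMap_le_iff_le_spectrum hB.isSelfAdjoint, hB.spectrum_real_eq_range_eigenvalues]
    exact Set.forall_mem_range.2 hμ
  have hnonneg := (Matrix.le_iff.1 hle).dotProduct_mulVec_nonneg v
  rw [star_trivial, sub_mulVec, dotProduct_sub, Algebra.algebraMap_eq_smul_one, smul_mulVec,
    one_mulVec, dotProduct_smul, smul_eq_mul] at hnonneg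
  exact sub_nonneg.1 hnonneg

end Matrix

theorem mul_norm_le_norm_of_forall_le {ι : Type*} [Fintype ι] {f v w : EuclideanSpace ℝ ι}
    {c : ℝ} (hf : ∀ i, 0 ≤ f i) (hvw : ∀ i, v i ≤ w i) (hv : c * ‖f‖ ^ 2 ≤ inner ℝ f v) :
    c * ‖f‖ ≤ ‖w‖ := by
  have hinner : inner ℝ f v ≤ inner ℝ f w := by
    simp only [PiLp.inner_apply, RCLike.inner_apply, conj_trivial]
    exact Finset.sum_le_sum fun i _ ↦ mul_le_mul_of_nonneg_right (hvw i) (hf i)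
  rcases (norm_nonneg f).eq_or_lt with h₀ | h₀
  · simp [← h₀]
  · refine le_of_mul_le_mul_left ?_ h₀
    calc ‖f‖ * (c * ‖f‖) = c * ‖f‖ ^ 2 := by ring
      _ ≤ inner ℝ f w := hv.trans hinner
      _ ≤ ‖f‖ * ‖w‖ := real_inner_le_norm f w

section DiscreteLaplacian

variable {m n : ℕ} {δ : ℝ} {u v : (Fin m → ℤ) → ℝ} {z : Fin m → ℤ} {D : Set (Fin m → ℤ)}

theorem discreteLaplacian_le_of_le (huv : ∀ y, u y ≤ v y) (hz : u z = v z) :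
    discreteLaplacian δ u z ≤ discreteLaplacian δ v z := by
  unfold discreteLaplacian
  rw [hz]
  gcongr <;> exact huv _

theorem isDiscreteSubharmonic_const (c : ℝ) : IsDiscreteSubharmonic δ (fun _ ↦ c) D := by
  intro z _
  simp only [discreteLaplacian, Finset.sum_const, Finset.card_univ, Fintype.card_fin, nsmul_eq_mul]
  exact le_of_eq (by ring)

theorem IsDiscreteSubharmonic.max (hu : IsDiscreteSubharmonic δ u D)
    (hv : IsDiscreteSubharmonic δ v D) : IsDiscreteSubharmonic δ (fun z ↦ max (u z) (v z)) D := by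
  intro z hz
  rcases le_total (u z) (v z) with h | h
  · exact (hv z hz).trans
      (discreteLaplacian_le_of_le (fun _ ↦ le_max_right _ _) (max_eq_right h).symm)
  · exact (hu z hz).trans
      (discreteLaplacian_le_of_le (fun _ ↦ le_max_left _ _) (max_eq_left h).symm)

theorem snoc_add_single_castSucc (x : Fin n → ℤ) (t : ℤ) (j : Fin n) (c : ℤ) :
    (Fin.snoc x t : Fin (n + 1) → ℤ) + Pi.single j.castSucc c = Fin.snoc (x + Pi.single j c) t := by
  ext i
  refine Fin.lastCases ?_ (fun i ↦ ?_) i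
  · simp
  · simp [Pi.single_apply]

theorem snoc_add_single_last (x : Fin n → ℤ) (t c : ℤ) :
    (Fin.snoc x t : Fin (n + 1) → ℤ) + Pi.single (Fin.last n) c = Fin.snoc x (t + c) := by
  ext i
  refine Fin.lastCases ?_ (fun i ↦ ?_) i <;> simp

theorem discreteLaplacian_snoc (u : (Fin (n + 1) → ℤ) → ℝ) (x : Fin n → ℤ) (t : ℤ) :
    discreteLaplacian δ u (Fin.snoc x t) = discreteLaplacian δ (fun y ↦ u (Fin.snoc y t)) x
      + (δ ^ 2)⁻¹ * (u (Fin.snoc x (t + 1)) + u (Fin.snoc x (t - 1)) - 2 * u (Fin.snoc x t)) := by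
  simp only [discreteLaplacian, Fin.sum_univ_castSucc, sub_eq_add_neg _ (Pi.single _ _),
    ← Pi.single_neg, snoc_add_single_castSucc, snoc_add_single_last]
  push_cast
  simp only [← sub_eq_add_neg]
  ring

end DiscreteLaplacian

section Dirichlet

variable {m : ℕ} {δ : ℝ} {S : Finset (Fin m → ℤ)}

theorem extendByZero_coe (g : S → ℝ) (x : S) : extendByZero S g x = g x := by
  simp [extendByZero]

theorem extendByZero_of_notMem (g : S → ℝ) {z : Fin m → ℤ} (hz : z ∉ S) :
    extendByZero S g z = 0 := by
  simp [extendByZero, hz]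

theorem dirichletLaplacian_restrict {v : (Fin m → ℤ) → ℝ}
    (hv : ∀ z ∈ latticeBoundary (S : Set (Fin m → ℤ)), v z = 0) (x : S) :
    dirichletLaplacian δ S (fun y ↦ v y) x = -discreteLaplacian δ v x := by
  have hext : ∀ z, (∃ j, z + Pi.single j 1 ∈ S ∨ z - Pi.single j 1 ∈ S) →
      extendByZero S (fun y ↦ v y) z = v z := by
    intro z hz
    by_cases hzS : z ∈ S
    · exact extendByZero_coe _ ⟨z, hzS⟩
    · rw [extendByZero_of_notMem _ hzS, hv z ⟨hzS, hz⟩]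
  have hadd : ∀ j, extendByZero S (fun y ↦ v y) (x.1 + Pi.single j 1) = v (x.1 + Pi.single j 1) :=
    fun j ↦ hext _ ⟨j, Or.inr (by simp)⟩
  have hsub : ∀ j, extendByZero S (fun y ↦ v y) (x.1 - Pi.single j 1) = v (x.1 - Pi.single j 1) :=
    fun j ↦ hext _ ⟨j, Or.inl (by simp)⟩
  simp only [dirichletLaplacian, LinearMap.coe_mk, AddHom.coe_mk, discreteLaplacian,
    extendByZero_coe, hadd, hsub]

theorem sum_extendByZero_add_sq_le (g : S → ℝ) (v : Fin m → ℤ) :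
    ∑ x : S, extendByZero S g (x + v) ^ 2 ≤ ∑ x : S, g x ^ 2 := by
  have hshift : ∑ x : S, extendByZero S g (x + v) ^ 2
      = ∑ z ∈ S.map (addRightEmbedding v), extendByZero S g z ^ 2 := by
    rw [Finset.sum_map, ← Finset.sum_coe_sort S]
    rfl
  have hg : ∑ x : S, g x ^ 2 = ∑ z ∈ S, extendByZero S g z ^ 2 := by
    rw [← Finset.sum_coe_sort S]
    simp only [extendByZero_coe]
  rw [hshift, hg]
  calc ∑ z ∈ S.map (addRightEmbedding v), extendByZero S g z ^ 2
      ≤ ∑ z ∈ S ∪ S.map (addRightEmbedding v), extendByZero S g z ^ 2 :=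
        Finset.sum_le_sum_of_subset_of_nonneg Finset.subset_union_right fun _ _ _ ↦ sq_nonneg _
    _ = ∑ z ∈ S, extendByZero S g z ^ 2 :=
        (Finset.sum_subset Finset.subset_union_left fun z _ hz ↦ by
          rw [extendByZero_of_notMem g hz, zero_pow two_ne_zero]).symm

theorem sum_mul_extendByZero_add_le (g : S → ℝ) (v : Fin m → ℤ) :
    ∑ x : S, g x * extendByZero S g (x + v) ≤ ∑ x : S, g x ^ 2 :=
  calc ∑ x : S, g x * extendByZero S g (x + v)
      ≤ ∑ x : S, (g x ^ 2 + extendByZero S g (x + v) ^ 2) / 2 :=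
        Finset.sum_le_sum fun x _ ↦ by linarith [two_mul_le_add_sq (g x) (extendByZero S g (x + v))]
    _ = (∑ x : S, g x ^ 2 + ∑ x : S, extendByZero S g (x + v) ^ 2) / 2 := by
        rw [← Finset.sum_div, Finset.sum_add_distrib]
    _ ≤ ∑ x : S, g x ^ 2 := by linarith [sum_extendByZero_add_sq_le g v]

theorem dotProduct_dirichletLaplacian_nonneg (δ : ℝ) (g : S → ℝ) :
    0 ≤ g ⬝ᵥ dirichletLaplacian δ S g := by
  have happly : ∀ x : S, g x * dirichletLaplacian δ S g x = (δ ^ 2)⁻¹ * ∑ j : Fin m,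
      (2 * g x ^ 2 - g x * extendByZero S g (x.1 + Pi.single j 1)
        - g x * extendByZero S g (x.1 + -Pi.single j 1)) := fun x ↦ by
    simp only [dirichletLaplacian, LinearMap.coe_mk, AddHom.coe_mk, discreteLaplacian,
      extendByZero_coe, Finset.sum_sub_distrib, Finset.sum_add_distrib, ← Finset.mul_sum,
      Finset.sum_const, Finset.card_univ, Fintype.card_fin, nsmul_eq_mul, ← sub_eq_add_neg]
    ring
  simp only [dotProduct, happly]
  rw [← Finset.mul_sum, Finset.sum_comm]
  refine mul_nonneg (by positivity) (Finset.sum_nonneg fun j _ ↦ ?_)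
  rw [Finset.sum_sub_distrib, Finset.sum_sub_distrib, ← Finset.mul_sum]
  linarith [sum_mul_extendByZero_add_le g (Pi.single j 1),
    sum_mul_extendByZero_add_le g (-Pi.single j 1)]

variable (δ S)

theorem dirichletMatrix_mulVec (g : S → ℝ) :
    (dirichletMatrix δ S).mulVec g = dirichletLaplacian δ S g := by
  rw [dirichletMatrix, LinearMap.toMatrix'_mulVec]

theorem dirichletMatrix_posSemidef : (dirichletMatrix δ S).PosSemidef := by
  refine .of_dotProduct_mulVec_nonneg (dirichletMatrix_isHermitian δ S) fun g ↦ ?_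
  rw [star_trivial, dirichletMatrix_mulVec]
  exact dotProduct_dirichletLaplacian_nonneg δ g

theorem dirichletEigenvalue_nonneg (k : ℕ) : 0 ≤ dirichletEigenvalue δ S k := by
  unfold dirichletEigenvalue
  split_ifs with hk
  · simpa [Matrix.IsHermitian.eigenvalues] using (dirichletMatrix_posSemidef δ S).eigenvalues_nonneg
      (Fintype.equivOfCardEq (Fintype.card_fin _) (Fin.rev ⟨k - 1, by lia⟩))
  · exact le_rfl

variable {S} in
theorem dirichletEigenvalue_one_le_eigenvalues (i : S) :
    dirichletEigenvalue δ S 1 ≤ (dirichletMatrix_isHermitian δ S).eigenvalues i := by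
  rw [dirichletEigenvalue, dif_pos ⟨le_rfl, Fintype.card_pos_iff.2 ⟨i⟩⟩]
  refine Matrix.IsHermitian.eigenvalues₀_antitone _ ?_
  rw [Fin.le_def, Fin.val_rev]
  simp only [Nat.sub_self]
  lia

theorem dirichletEigenvalue_one_mul_norm_sq_le (g : EuclideanSpace ℝ S) :
    dirichletEigenvalue δ S 1 * ‖g‖ ^ 2
      ≤ inner ℝ g (WithLp.toLp 2 (dirichletLaplacian δ S g)) := by
  have hrayleigh := mul_dotProduct_self_le_dotProduct_mulVec (dirichletMatrix_isHermitian δ S)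
    (dirichletEigenvalue_one_le_eigenvalues δ) g
  rw [dirichletMatrix_mulVec, dotProduct_comm _ (dirichletLaplacian δ S g)] at hrayleigh
  rwa [← real_inner_self_eq_norm_sq, EuclideanSpace.inner_eq_star_dotProduct,
    EuclideanSpace.inner_eq_star_dotProduct, star_trivial]

variable {δ} in
theorem two_mul_cosh_mul_cylinderExponent (hδ : δ ≠ 0) (k : ℕ) :
    2 * Real.cosh (δ * cylinderExponent δ S k) = 2 + δ ^ 2 * dirichletEigenvalue δ S k := by
  have hnonneg : 0 ≤ δ ^ 2 * dirichletEigenvalue δ S k :=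
    mul_nonneg (sq_nonneg δ) (dirichletEigenvalue_nonneg δ S k)
  rw [cylinderExponent, mul_inv_cancel_left₀ hδ, Real.cosh_arcosh (by linarith)]
  ring

end Dirichlet

section PositiveSlice

variable {n : ℕ} {S : Finset (Fin n → ℤ)} {δ : ℝ} {u : (Fin (n + 1) → ℤ) → ℝ} {t : ℤ}

/-- The positive part of `u` on the cross-section `S × {t}` of a cylinder, as a vector of the
Euclidean space over `S`, so that its norm is the `ℓ²` norm of the slice. -/
noncomputable def positiveSlice (S : Finset (Fin n → ℤ)) (u : (Fin (n + 1) → ℤ) → ℝ) (t : ℤ) :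
    EuclideanSpace ℝ S :=
  WithLp.toLp 2 fun x ↦ max 0 (u (Fin.snoc x.1 t))

theorem norm_positiveSlice_sq (S : Finset (Fin n → ℤ)) (u : (Fin (n + 1) → ℤ) → ℝ) (t : ℤ) :
    ‖positiveSlice S u t‖ ^ 2 = ∑ x ∈ S, max 0 (u (Fin.snoc x t)) ^ 2 := by
  rw [EuclideanSpace.real_norm_sq_eq, ← Finset.sum_coe_sort S]
  rfl

theorem norm_positiveSlice_le {M : ℝ} (hM : ∀ x ∈ S, u (Fin.snoc x t) ≤ M) :
    ‖positiveSlice S u t‖ ≤ max 0 M * √S.card := by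
  refine le_of_sq_le_sq ?_ (by positivity)
  rw [norm_positiveSlice_sq, mul_pow, Real.sq_sqrt (Nat.cast_nonneg _), mul_comm, ← nsmul_eq_mul]
  refine Finset.sum_le_card_nsmul _ _ _ fun x hx ↦ ?_
  gcongr
  exact hM x hx

theorem two_mul_positiveSlice_add_le (hδ : δ ≠ 0)
    (hu : ∀ x ∈ S, 0 ≤ discreteLaplacian δ u (Fin.snoc x t))
    (hu₀ : ∀ x ∈ latticeBoundary (S : Set (Fin n → ℤ)), u (Fin.snoc x t) = 0) (x : S) :
    2 * positiveSlice S u t x + δ ^ 2 * dirichletLaplacian δ S (positiveSlice S u t) x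
      ≤ positiveSlice S u (t + 1) x + positiveSlice S u (t - 1) x := by
  have hsub : IsDiscreteSubharmonic δ (fun p ↦ max 0 (u p)) {Fin.snoc x.1 t} :=
    (isDiscreteSubharmonic_const 0).max (by rintro _ rfl; exact hu x x.2)
  have hL : dirichletLaplacian δ S (positiveSlice S u t) x
      = -discreteLaplacian δ (fun y ↦ max 0 (u (Fin.snoc y t))) x :=
    dirichletLaplacian_restrict (v := fun y ↦ max 0 (u (Fin.snoc y t)))
      (fun z hz ↦ by rw [hu₀ z hz, max_self]) x
  have hnonneg := mul_nonneg (sq_nonneg δ) (hsub _ rfl)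
  rw [discreteLaplacian_snoc, mul_add, mul_inv_cancel_left₀ (pow_ne_zero 2 hδ)] at hnonneg
  rw [hL]
  simp only [positiveSlice]
  linarith

theorem two_mul_cosh_mul_norm_positiveSlice_le (hδ : δ ≠ 0)
    (hu : ∀ x ∈ S, 0 ≤ discreteLaplacian δ u (Fin.snoc x t))
    (hu₀ : ∀ x ∈ latticeBoundary (S : Set (Fin n → ℤ)), u (Fin.snoc x t) = 0) :
    2 * Real.cosh (δ * cylinderExponent δ S 1) * ‖positiveSlice S u t‖
      ≤ ‖positiveSlice S u (t + 1)‖ + ‖positiveSlice S u (t - 1)‖ := by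
  set f := positiveSlice S u t
  have hform : (2 + δ ^ 2 * dirichletEigenvalue δ S 1) * ‖f‖ ^ 2
      ≤ inner ℝ f ((2 : ℝ) • f + δ ^ 2 • WithLp.toLp 2 (dirichletLaplacian δ S f)) := by
    rw [inner_add_right, real_inner_smul_right, real_inner_smul_right, real_inner_self_eq_norm_sq]
    linear_combination mul_le_mul_of_nonneg_left
      (dirichletEigenvalue_one_mul_norm_sq_le δ S f) (sq_nonneg δ)
  rw [two_mul_cosh_mul_cylinderExponent S hδ]
  refine (mul_norm_le_norm_of_forall_le (fun x ↦ le_max_left _ _) (fun x ↦ ?_) hform).trans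
    (norm_add_le _ _)
  simpa using two_mul_positiveSlice_add_le hδ hu hu₀ x

end PositiveSlice

section Cylinder

variable {n : ℕ} {Ω : Set (EuclideanSpace ℝ (Fin n))} {δ : ℝ} {m : ℕ} {x : Fin n → ℤ} {t : ℤ}

theorem coe_latticeFinset (hΩ : Bornology.IsBounded Ω) (hδ : 0 < δ) :
    (latticeFinset hΩ hδ : Set (Fin n → ℤ)) = latticePoints Ω δ :=
  (latticePoints_finite hΩ hδ).coe_toFinset

theorem mem_latticeFinset {hΩ : Bornology.IsBounded Ω} {hδ : 0 < δ} :
    x ∈ latticeFinset hΩ hδ ↔ x ∈ latticePoints Ω δ :=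
  (latticePoints_finite hΩ hδ).mem_toFinset

theorem abs_mul_intCast_le_iff (hδ : 0 < δ) : |δ * (t : ℝ)| ≤ m * δ ↔ |t| ≤ m := by
  rw [abs_mul, abs_of_pos hδ, mul_comm, mul_le_mul_iff_left₀ hδ]
  exact_mod_cast Iff.rfl

theorem abs_mul_intCast_lt_iff (hδ : 0 < δ) : |δ * (t : ℝ)| < m * δ ↔ |t| < m := by
  rw [abs_mul, abs_of_pos hδ, mul_comm, mul_lt_mul_iff_left₀ hδ]
  exact_mod_cast Iff.rfl

theorem snoc_mem_truncatedCylinder (hδ : 0 < δ) :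
    (Fin.snoc x t : Fin (n + 1) → ℤ) ∈ truncatedCylinder Ω δ (m * δ) ↔
      x ∈ latticePoints Ω δ ∧ |t| ≤ m := by
  simp only [truncatedCylinder, Set.mem_ofPred_eq, Fin.init_snoc, Fin.snoc_last,
    abs_mul_intCast_le_iff hδ]

theorem snoc_mem_openTruncatedCylinder (hδ : 0 < δ) :
    (Fin.snoc x t : Fin (n + 1) → ℤ) ∈ openTruncatedCylinder Ω δ (m * δ) ↔
      x ∈ latticePoints Ω δ ∧ |t| < m := by
  simp only [openTruncatedCylinder, Set.mem_ofPred_eq, Fin.init_snoc, Fin.snoc_last,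
    abs_mul_intCast_lt_iff hδ]

theorem snoc_mem_lateralBoundary (hδ : 0 < δ) :
    (Fin.snoc x t : Fin (n + 1) → ℤ) ∈ lateralBoundary Ω δ (m * δ) ↔
      x ∈ latticeBoundary (latticePoints Ω δ) ∧ |t| ≤ m := by
  simp only [lateralBoundary, Set.mem_ofPred_eq, Fin.init_snoc, Fin.snoc_last,
    abs_mul_intCast_le_iff hδ]

theorem truncatedCylinder_finite (hΩ : Bornology.IsBounded Ω) (hδ : 0 < δ) (m : ℕ) :
    (truncatedCylinder Ω δ (m * δ)).Finite := by
  refine (((latticePoints_finite hΩ hδ).prod (Set.finite_Icc (-(m : ℤ)) m)).image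
    fun q ↦ (Fin.snoc q.1 q.2 : Fin (n + 1) → ℤ)).subset fun p hp ↦ ?_
  rw [← Fin.snoc_init_self (α := fun _ ↦ ℤ) p, snoc_mem_truncatedCylinder hδ] at hp
  exact ⟨(Fin.init p, p (Fin.last n)), ⟨hp.1, abs_le.1 hp.2⟩, Fin.snoc_init_self _⟩

namespace IsPositiveCylinderSubsolution

variable {hΩ : Bornology.IsBounded Ω} {hδ : 0 < δ} {N A M : ℝ} {u : (Fin (n + 1) → ℤ) → ℝ}

theorem ne_zero (h : IsPositiveCylinderSubsolution hΩ hδ N A u) : A ≠ 0 :=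
  fun hA ↦ h.pos.ne' (by simp [hA])

theorem card_pos (h : IsPositiveCylinderSubsolution hΩ hδ N A u) :
    0 < (latticeFinset hΩ hδ).card :=
  Nat.pos_of_ne_zero fun h₀ ↦ h.pos.ne' (by simp [h₀])

theorem norm_positiveSlice_zero (h : IsPositiveCylinderSubsolution hΩ hδ N A u) :
    ‖positiveSlice (latticeFinset hΩ hδ) u 0‖ = |A| * √(latticeFinset hΩ hδ).card := by
  rw [← Real.sqrt_sq (norm_nonneg _), norm_positiveSlice_sq, h.sum_eq,
    Real.sqrt_mul (sq_nonneg A), Real.sqrt_sq_eq_abs]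

theorem exists_isGreatest (h : IsPositiveCylinderSubsolution hΩ hδ (m * δ) A u) :
    ∃ M, IsGreatest (u '' truncatedCylinder Ω δ (m * δ)) M := by
  obtain ⟨x, hx⟩ := Finset.card_pos.1 h.card_pos
  have hx₀ : (Fin.snoc x (0 : ℤ) : Fin (n + 1) → ℤ) ∈ truncatedCylinder Ω δ (m * δ) :=
    (snoc_mem_truncatedCylinder hδ).2 ⟨mem_latticeFinset.1 hx, by simp⟩
  exact ((truncatedCylinder_finite hΩ hδ m).image u).isCompact.exists_isGreatest
    ⟨_, Set.mem_image_of_mem u hx₀⟩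

theorem two_mul_cosh_mul_norm_positiveSlice_zero_le
    (h : IsPositiveCylinderSubsolution hΩ hδ (m * δ) A u) :
    2 * (Real.cosh (cylinderExponent δ (latticeFinset hΩ hδ) 1 * (m * δ))
        * ‖positiveSlice (latticeFinset hΩ hδ) u 0‖)
      ≤ ‖positiveSlice (latticeFinset hΩ hδ) u m‖
        + ‖positiveSlice (latticeFinset hΩ hδ) u (-m)‖ := by
  rw [show ∀ a : ℝ, a * (m * δ) = m * (δ * a) from fun a ↦ by ring]
  refine two_mul_cosh_mul_le_of_recurrence (q := fun t ↦ ‖positiveSlice _ u t‖) fun t ht ↦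
    two_mul_cosh_mul_norm_positiveSlice_le hδ.ne' (fun x hx ↦ h.subharmonic _ ?_)
      fun x hx ↦ h.eq_zero _ ?_
  · exact (snoc_mem_openTruncatedCylinder hδ).2 ⟨mem_latticeFinset.1 hx, ht⟩
  · exact (snoc_mem_lateralBoundary hδ).2 ⟨coe_latticeFinset hΩ hδ ▸ hx, ht.le⟩

theorem cosh_mul_abs_le (h : IsPositiveCylinderSubsolution hΩ hδ (m * δ) A u)
    (hM : M ∈ upperBounds (u '' truncatedCylinder Ω δ (m * δ))) :
    Real.cosh (cylinderExponent δ (latticeFinset hΩ hδ) 1 * (m * δ)) * |A| ≤ M := by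
  set c := Real.cosh (cylinderExponent δ (latticeFinset hΩ hδ) 1 * (m * δ))
  have hslice : ∀ t : ℤ, |t| ≤ m →
      ‖positiveSlice (latticeFinset hΩ hδ) u t‖ ≤ max 0 M * √(latticeFinset hΩ hδ).card :=
    fun t ht ↦ norm_positiveSlice_le fun x hx ↦ hM <| Set.mem_image_of_mem u <|
      (snoc_mem_truncatedCylinder hδ).2 ⟨mem_latticeFinset.1 hx, ht⟩
  have hgrowth := h.two_mul_cosh_mul_norm_positiveSlice_zero_le
  rw [h.norm_positiveSlice_zero] at hgrowth
  have hmax : c * |A| ≤ max 0 M := by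
    refine le_of_mul_le_mul_right ?_ (Real.sqrt_pos.2 (Nat.cast_pos.2 h.card_pos))
    linarith [hslice m (by simp), hslice (-m) (by simp)]
  have hpos : 0 < c * |A| := mul_pos (Real.cosh_pos _) (abs_pos.2 h.ne_zero)
  exact (le_max_iff.1 hmax).resolve_left hpos.not_ge

end IsPositiveCylinderSubsolution

end Cylinder

theorem theorem4_general {n : ℕ} {Ω : Set (EuclideanSpace ℝ (Fin n))}
    (hbdd : Bornology.IsBounded Ω) {δ : ℝ} (hδ : 0 < δ) {N : ℝ} (hN : ∃ m : ℕ, N = m * δ)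
    {A : ℝ} {u : (Fin (n + 1) → ℤ) → ℝ} (h : IsPositiveCylinderSubsolution hbdd hδ N A u) :
    ∃ M : ℝ, IsGreatest (u '' truncatedCylinder Ω δ N) M ∧
      A / 2 * (∑ k ∈ Finset.Icc 1 (latticeFinset hbdd hδ).card,
        Real.exp (-(cylinderExponent δ (latticeFinset hbdd hδ) k * N)))⁻¹ ≤ M ∧
      1 / 2 * A * Real.exp (cylinderExponent δ (latticeFinset hbdd hδ) 1 * N) ≤ M := by
  obtain ⟨m, rfl⟩ := hN
  obtain ⟨M, hM⟩ := h.exists_isGreatest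
  set a := cylinderExponent δ (latticeFinset hbdd hδ)
  have hexp : |A| / 2 * Real.exp (a 1 * (m * δ)) ≤ M :=
    calc |A| / 2 * Real.exp (a 1 * (m * δ)) = Real.exp (a 1 * (m * δ)) / 2 * |A| := by ring
      _ ≤ Real.cosh (a 1 * (m * δ)) * |A| := by gcongr; exact exp_half_le_cosh _
      _ ≤ M := h.cosh_mul_abs_le hM.2
  have hsum := inv_sum_exp_neg_le_exp (Finset.mem_Icc.2 ⟨le_rfl, h.card_pos⟩)
    fun k ↦ a k * (m * δ)
  refine ⟨M, hM, le_trans ?_ hexp, le_trans ?_ hexp⟩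
  · gcongr
    exact le_abs_self A
  · rw [one_div_mul_eq_div]
    gcongr
    exact le_abs_self A

theorem theorem4 (n : ℕ) (hn : 1 ≤ n) (Ω : Set (EuclideanSpace ℝ (Fin n)))
    (hopen : IsOpen Ω) (hconn : IsConnected Ω) (hbdd : Bornology.IsBounded Ω) :
    (∀ (δ : ℝ) (hδ : 0 < δ) (N : ℝ), (∃ m : ℕ, N = m * δ) →
      ∀ (A : ℝ) (u : (Fin (n + 1) → ℤ) → ℝ),
        IsPositiveCylinderSubsolution hbdd hδ N A u →
        ∃ M : ℝ, IsGreatest (u '' truncatedCylinder Ω δ N) M ∧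
          A / 2 * (∑ k ∈ Finset.Icc 1 (latticeFinset hbdd hδ).card,
            Real.exp (-(cylinderExponent δ (latticeFinset hbdd hδ) k * N)))⁻¹ ≤ M) ∧
    (∃ C : ℝ, 0 < C ∧
      ∀ (δ : ℝ) (hδ : 0 < δ) (N : ℕ), (∃ m : ℕ, (N : ℝ) = m * δ) →
        ∀ (A : ℝ) (u : (Fin (n + 1) → ℤ) → ℝ),
          IsPositiveCylinderSubsolution hbdd hδ N A u →
          ∃ M : ℝ, IsGreatest (u '' truncatedCylinder Ω δ N) M ∧
            C * A * Real.exp (cylinderExponent δ (latticeFinset hbdd hδ) 1 * N) ≤ M) := by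
  refine ⟨fun δ hδ N hN A u h ↦ ?_, 1 / 2, by norm_num, fun δ hδ N hN A u h ↦ ?_⟩
  · exact (theorem4_general hbdd hδ hN h).imp fun _ hM ↦ ⟨hM.1, hM.2.1⟩
  · exact (theorem4_general hbdd hδ hN h).imp fun _ hM ↦ ⟨hM.1, hM.2.2⟩
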